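/- All Hilbert spaces are complex, $\mathbb T$ is the unit circle and $\mathbb D$ the open unit disk. Let $H$ be a separable Hilbert space and let $T(\lambda)=T_0+\lambda T_1$ be a linear pencil of bounded operators on $H$ such that $T(\lambda)$ is a contraction for every $\lambda\in\mathbb T$. Definitions. For a separable Hilbert space $X$, $H^2_X(\mathbb D)$ is the space of holomorphic $x:\mathbb D\to X$ with $\|x\|^2=\frac1{2\pi}\sup_{0<r<1}\int_0^{2\pi}\|x(re^{is})\|^2\,ds<\infty$. A holomorphic function $\theta$ on $\mathbb D$ whose values are contractions from $X$ to $Y$ is outer if $\theta H^2_X(\mathbb D)$ is dense in $H^2_Y(\mathbb D)$. A linear pencil $S(\lambda)=S_0+\lambda S_1$ on a Hilbert space $K\supseteq H$ is a dilation of $T(\lambda)$ if $T(\lambda)^n=P_H S(\lambda)^n|_H$ for all $\lambda\in\mathbb T$, $n\ge 0$; it is a uniform dilation if, moreover, $T(\lambda_1)\cdots T(\lambda_n)=P_H S(\lambda_1)\cdots S(\lambda_n)|_H$ for all $n$ and all $\lambda_1,\dots,\lambda_n\in\mathbb T$; it is an isometric (resp. uniform isometric) dilation if, in addition, $S(\lambda)$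 is an isometry for every $\lambda\in\mathbb T$. An isometric (resp. uniform isometric) dilation $S(\lambda)$ of $T(\lambda)$ on $K$ is minimal if the only closed subspace $L$ with $H\subseteq L\subseteq K$ for which the compression $P_L S(\lambda)|_L$ is again an isometric (resp. uniform isometric) dilation of $T(\lambda)$ is $L=K$. Theorem. (1) There exist a separable Hilbert space $Y$ and a linear outer function $F(z)=F_0+zF_1$ with values bounded operators from $H$ to $Y$ such that $$F(\lambda)^*F(\lambda)=I_H-T(\lambda)^*T(\lambda)\qquad(\lambda\in\mathbb T).$$ (2) For every such $Y$ and $F$, let $K_+=\bigl(\bigoplus_{k=-\infty}^{-1}Y\bigr)\oplus H$, where $H$ is identified with the last summand, and let $$V(\lambda)\,\mathrm{col}(\dots,y_{-2},y_{-1},h)=\mathrm{col}(\dots,y_{-2},y_{-1},F(\lambda)h,T(\lambda)h),$$ so that the component of index $-1$ of the image is $F(\lambda)h$, the component of index $-(k+1)$ is $y_{-k}$ for $k\ge1$, and the component in $H$ is $T(\lambda)h$. Then the linear pencil $V(\lambda)$ is a minimal isometric dilation of $T(\lambda)$, and it is also a minimal uniform isometric dilation of $T(\lambda)$. -/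

import Mathlib

open scoped ENNReal
open ContinuousLinearMap

universe u v w

noncomputable section

/-! ### Linear pencils of operators -/

/-- A linear pencil `A(z) = A₀ + z A₁` of bounded operators from `E` to `F`. -/
structure LinearPencil (E : Type u) (F : Type v)
    [NormedAddCommGroup E] [InnerProductSpace ℂ E]
    [NormedAddCommGroup F] [InnerProductSpace ℂ F] where
  /-- The constant coefficient `A₀`. -/
  coeff0 : E →L[ℂ] F
  /-- The linear coefficient `A₁`. -/
  coeff1 : E →L[ℂ] F

namespace LinearPencil

/-- The value `A(z) = A₀ + z A₁`. -/
def eval {E : Type u} {F : Type v}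
    [NormedAddCommGroup E] [InnerProductSpace ℂ E]
    [NormedAddCommGroup F] [InnerProductSpace ℂ F]
    (A : LinearPencil E F) (z : ℂ) : E →L[ℂ] F :=
  A.coeff0 + z • A.coeff1

/-- `A(ζ)` is a contraction for every `ζ` on the unit circle. -/
def IsContractive {E : Type u} [NormedAddCommGroup E] [InnerProductSpace ℂ E]
    (A : LinearPencil E E) : Prop :=
  ∀ ζ : ℂ, ‖ζ‖ = 1 → ‖A.eval ζ‖ ≤ 1

/-- `A(ζ)` is an isometry for every `ζ` on the unit circle. -/
def IsIsometric {E : Type u} [NormedAddCommGroup E] [InnerProductSpace ℂ E]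
    (A : LinearPencil E E) : Prop :=
  ∀ ζ : ℂ, ‖ζ‖ = 1 → ∀ x : E, ‖A.eval ζ x‖ = ‖x‖

/-- The compression `P_L A(z)|L` of a pencil on `K` to a closed subspace `L` of `K`. -/
def compress {K : Type w} [NormedAddCommGroup K] [InnerProductSpace ℂ K]
    (A : LinearPencil K K) (L : Submodule ℂ K) [CompleteSpace L] : LinearPencil L L where
  coeff0 := L.orthogonalProjectionOnto ∘L A.coeff0 ∘L L.subtypeL
  coeff1 := L.orthogonalProjectionOnto ∘L A.coeff1 ∘L L.subtypeL

end LinearPencil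

/-! ### Dilations

The inclusion `H ⊆ K` of Hilbert spaces is given by a linear isometry `ι : H → K`; then the
adjoint of `ι` is the orthogonal projection of `K` onto `H`. -/

section Dilations

variable {H : Type u} [NormedAddCommGroup H] [InnerProductSpace ℂ H] [CompleteSpace H]
  {K : Type w} [NormedAddCommGroup K] [InnerProductSpace ℂ K] [CompleteSpace K]

/-- `S` is a dilation of `T`: `T(ζ)ⁿ = P_H S(ζ)ⁿ|H` for all `|ζ| = 1` and `n ≥ 0`. -/
def IsDilation (ι : H →ₗᵢ[ℂ] K) (T : LinearPencil H H) (S : LinearPencil K K) : Prop :=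
  ∀ ζ : ℂ, ‖ζ‖ = 1 → ∀ n : ℕ,
    T.eval ζ ^ n =
      adjoint ι.toContinuousLinearMap ∘L (S.eval ζ ^ n) ∘L ι.toContinuousLinearMap

/-- `S` is a uniform dilation of `T`: it is a dilation, and
`T(ζ₁)⋯T(ζₙ) = P_H S(ζ₁)⋯S(ζₙ)|H` for every finite list `ζ₁, …, ζₙ` in the unit circle. -/
def IsUniformDilation (ι : H →ₗᵢ[ℂ] K) (T : LinearPencil H H) (S : LinearPencil K K) : Prop :=
  IsDilation ι T S ∧
  ∀ l : List ℂ, (∀ ζ ∈ l, ‖ζ‖ = 1) →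
    (l.map T.eval).prod =
      adjoint ι.toContinuousLinearMap ∘L (l.map S.eval).prod ∘L ι.toContinuousLinearMap

/-- `S` is an isometric dilation of the contractive pencil `T`. -/
def IsIsometricDilation (ι : H →ₗᵢ[ℂ] K) (T : LinearPencil H H) (S : LinearPencil K K) : Prop :=
  T.IsContractive ∧ S.IsIsometric ∧ IsDilation ι T S

/-- `S` is a uniform isometric dilation of the contractive pencil `T`. -/
def IsUniformIsometricDilation (ι : H →ₗᵢ[ℂ] K) (T : LinearPencil H H)
    (S : LinearPencil K K) : Prop :=
  T.IsContractive ∧ S.IsIsometric ∧ IsUniformDilation ι T S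

/-- `S` is minimal among the isometric dilations of `T`: no compression of `S` to a proper closed
subspace `L ⊇ H` is an isometric dilation of `T`. (Any pencil on `L` that has `S` as a dilation is
the compression of `S` to `L`.) -/
def IsMinimalIsometricDilation (ι : H →ₗᵢ[ℂ] K) (T : LinearPencil H H)
    (S : LinearPencil K K) : Prop :=
  IsIsometricDilation ι T S ∧
  ∀ (L : Submodule ℂ K) [CompleteSpace L] (κ : H →ₗᵢ[ℂ] L), (∀ h : H, (κ h : K) = ι h) →
    IsIsometricDilation κ T (S.compress L) → L = ⊤

/-- `S` is minimal among the uniform isometric dilations of `T`: no compression of `S` to a proper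
closed subspace `L ⊇ H` is a uniform isometric dilation of `T`. -/
def IsMinimalUniformIsometricDilation (ι : H →ₗᵢ[ℂ] K) (T : LinearPencil H H)
    (S : LinearPencil K K) : Prop :=
  IsUniformIsometricDilation ι T S ∧
  ∀ (L : Submodule ℂ K) [CompleteSpace L] (κ : H →ₗᵢ[ℂ] L), (∀ h : H, (κ h : K) = ι h) →
    IsUniformIsometricDilation κ T (S.compress L) → L = ⊤

end Dilations

/-! ### Hardy space and outer functions -/

/-- The squared Hardy norm `(2π)⁻¹ sup_{0<r<1} ∫₀^{2π} ‖x(r e^{is})‖² ds` of a function on the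
unit disk (only the values of `x` on the open unit disk matter). -/
def hardyNormSq {X : Type u} [NormedAddCommGroup X] (x : ℂ → X) : ℝ≥0∞ :=
  ENNReal.ofReal (2 * Real.pi)⁻¹ *
    ⨆ r ∈ Set.Ioo (0 : ℝ) 1, ∫⁻ s in Set.Ioc 0 (2 * Real.pi), ‖x (circleMap 0 r s)‖ₑ ^ 2

/-- `x` is holomorphic on the open unit disk and of finite Hardy norm, i.e. `x ∈ H²_X(𝔻)`. -/
def MemHardy {X : Type u} [NormedAddCommGroup X] [NormedSpace ℂ X] (x : ℂ → X) : Prop :=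
  DifferentiableOn ℂ x (Metric.ball 0 1) ∧ hardyNormSq x < ∞

/-- A contractive holomorphic operator function `θ` on the open unit disk is outer if
`θ H²_X(𝔻)` is dense in `H²_Y(𝔻)`. -/
def IsOuter {X : Type u} {Y : Type v} [NormedAddCommGroup X] [NormedSpace ℂ X]
    [NormedAddCommGroup Y] [NormedSpace ℂ Y] (θ : ℂ → X →L[ℂ] Y) : Prop :=
  DifferentiableOn ℂ θ (Metric.ball 0 1) ∧
  (∀ z ∈ Metric.ball (0 : ℂ) 1, ‖θ z‖ ≤ 1) ∧
  ∀ y : ℂ → Y, MemHardy y → ∀ ε : ℝ≥0∞, 0 < ε →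
    ∃ x : ℂ → X, MemHardy x ∧ hardyNormSq (fun z => y z - θ z (x z)) < ε

/-- `F(z) = F₀ + z F₁` is a linear outer function with
`F(ζ)* F(ζ) = I - T(ζ)* T(ζ)` for all `|ζ| = 1`. -/
def IsOuterFactor {H : Type u} [NormedAddCommGroup H] [InnerProductSpace ℂ H] [CompleteSpace H]
    {Y : Type v} [NormedAddCommGroup Y] [InnerProductSpace ℂ Y] [CompleteSpace Y]
    (T : LinearPencil H H) (F : LinearPencil H Y) : Prop :=
  IsOuter F.eval ∧
  ∀ ζ : ℂ, ‖ζ‖ = 1 →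
    adjoint (F.eval ζ) ∘L F.eval ζ =
      ContinuousLinearMap.id ℂ H - adjoint (T.eval ζ) ∘L T.eval ζ

/-! ### The canonical pencil -/

section Canonical

/-- The sequence `(0, y₀, y₁, …)`. -/
def shiftFun {Y : Type v} [Zero Y] (y : ℕ → Y) : ℕ → Y
  | 0 => 0
  | k + 1 => y k

theorem hasSum_shiftFun {Y : Type v} [NormedAddCommGroup Y] (y : lp (fun _ : ℕ => Y) 2) :
    HasSum (fun k => ‖shiftFun y k‖ ^ (2 : ℝ≥0∞).toReal) (‖y‖ ^ (2 : ℝ≥0∞).toReal) := by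
  have h := lp.hasSum_norm (p := 2) (by norm_num) y
  rw [← hasSum_nat_add_iff' 1]
  simpa [shiftFun] using h

variable (Y : Type v) [NormedAddCommGroup Y] [InnerProductSpace ℂ Y]
  (H : Type u) [NormedAddCommGroup H] [InnerProductSpace ℂ H]

/-- The space `K₊ = (⨁_{-∞}^{-1} Y) ⊕ H` (Hilbert space direct sums). The entry with index
`k : ℕ` of the sequence is the component with index `-(k+1)` of `⨁_{-∞}^{-1} Y`. -/
abbrev KPlus : Type (max v u) := WithLp 2 (lp (fun _ : ℕ => Y) 2 × H)

/-- The shift `(y₀, y₁, …) ↦ (0, y₀, y₁, …)` on `⨁_{-∞}^{-1} Y`. -/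
def shift : lp (fun _ : ℕ => Y) 2 →ₗᵢ[ℂ] lp (fun _ : ℕ => Y) 2 where
  toFun y := ⟨shiftFun y, memℓp_gen (hasSum_shiftFun y).summable⟩
  map_add' y y' := by
    ext k
    change shiftFun (y + y' : lp (fun _ : ℕ => Y) 2) k = shiftFun y k + shiftFun y' k
    cases k <;> simp [shiftFun]
  map_smul' c y := by
    ext k
    change shiftFun (c • y : lp (fun _ : ℕ => Y) 2) k = c • shiftFun y k
    cases k <;> simp [shiftFun]
  norm_map' y := by
    have h1 := lp.hasSum_norm (p := 2) (by norm_num)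
      (⟨shiftFun y, memℓp_gen (hasSum_shiftFun y).summable⟩ : lp (fun _ : ℕ => Y) 2)
    have h2 := h1.unique (hasSum_shiftFun y)
    exact (Real.rpow_left_inj (norm_nonneg _) (norm_nonneg _) (by norm_num)).1 h2

/-- The embedding of `Y` as the component with index `-1` of `⨁_{-∞}^{-1} Y`. -/
def lastComponent : Y →ₗᵢ[ℂ] lp (fun _ : ℕ => Y) 2 where
  toLinearMap := lp.lsingle (𝕜 := ℂ) (E := fun _ : ℕ => Y) 2 0
  norm_map' y := lp.norm_single (E := fun _ : ℕ => Y) (by norm_num) 0 y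

/-- The embedding `h ↦ col(…, 0, 0, h)` of `H` into `K₊`. -/
def embedKPlus : H →ₗᵢ[ℂ] KPlus Y H where
  toFun h := WithLp.toLp 2 (0, h)
  map_add' h h' := by
    rw [← WithLp.toLp_add]
    simp
  map_smul' c h := by
    rw [RingHom.id_apply, ← WithLp.toLp_smul]
    simp
  norm_map' h := WithLp.norm_toLp_snd 2 (lp (fun _ : ℕ => Y) 2) H h

variable {Y H}

/-- The operator on `K₊` given by the block column `col(B, A)` in the column of `H`, with
`B : H → Y` in the row with index `-1` and `A : H → H` in the row of `H`, and zeros elsewhere. -/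
def blockColumn (B : H →L[ℂ] Y) (A : H →L[ℂ] H) : KPlus Y H →L[ℂ] KPlus Y H :=
  (WithLp.prodContinuousLinearEquiv 2 ℂ (lp (fun _ : ℕ => Y) 2) H).symm.toContinuousLinearMap ∘L
    (((lastComponent Y).toContinuousLinearMap ∘L B).prod A) ∘L
    ContinuousLinearMap.snd ℂ (lp (fun _ : ℕ => Y) 2) H ∘L
    (WithLp.prodContinuousLinearEquiv 2 ℂ (lp (fun _ : ℕ => Y) 2) H).toContinuousLinearMap

/-- The operator on `K₊` with the identities `I_Y` from the component `-k` to the component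
`-(k+1)`, `k ≥ 1`, and zeros elsewhere. -/
def blockShift : KPlus Y H →L[ℂ] KPlus Y H :=
  (WithLp.prodContinuousLinearEquiv 2 ℂ (lp (fun _ : ℕ => Y) 2) H).symm.toContinuousLinearMap ∘L
    ((shift Y).toContinuousLinearMap.prod 0) ∘L
    ContinuousLinearMap.fst ℂ (lp (fun _ : ℕ => Y) 2) H ∘L
    (WithLp.prodContinuousLinearEquiv 2 ℂ (lp (fun _ : ℕ => Y) 2) H).toContinuousLinearMap

/-- The pencil `V(z)` on `K₊` whose matrix has the identities `I_Y` from the component `-k` to the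
component `-(k+1)`, `k ≥ 1`, the entry `F(z)` from `H` to the component `-1`, the entry `T(z)`
from `H` to `H`, and zeros elsewhere. -/
def canonicalPencil (T : LinearPencil H H) (F : LinearPencil H Y) :
    LinearPencil (KPlus Y H) (KPlus Y H) where
  coeff0 := blockShift + blockColumn F.coeff0 T.coeff0
  coeff1 := blockColumn F.coeff1 T.coeff1

theorem canonicalPencil_eval_snd (T : LinearPencil H H) (F : LinearPencil H Y) (z : ℂ)
    (x : KPlus Y H) : ((canonicalPencil T F).eval z x).snd = T.eval z x.snd := by
  simp [canonicalPencil, LinearPencil.eval, blockShift, blockColumn]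

theorem canonicalPencil_eval_fst (T : LinearPencil H H) (F : LinearPencil H Y) (z : ℂ)
    (x : KPlus Y H) : ((canonicalPencil T F).eval z x).fst =
      shift Y x.fst + lastComponent Y (F.eval z x.snd) := by
  simp [canonicalPencil, LinearPencil.eval, blockShift, blockColumn, add_assoc]

theorem canonicalPencil_eval_fst_zero (T : LinearPencil H H) (F : LinearPencil H Y) (z : ℂ)
    (x : KPlus Y H) : ((canonicalPencil T F).eval z x).fst 0 = F.eval z x.snd := by
  rw [canonicalPencil_eval_fst, lp.coeFn_add, Pi.add_apply]
  change (0 : Y) + Pi.single (M := fun _ : ℕ => Y) 0 (F.eval z x.snd) 0 = _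
  simp

theorem canonicalPencil_eval_fst_succ (T : LinearPencil H H) (F : LinearPencil H Y) (z : ℂ)
    (x : KPlus Y H) (k : ℕ) :
    ((canonicalPencil T F).eval z x).fst (k + 1) = x.fst k := by
  rw [canonicalPencil_eval_fst, lp.coeFn_add, Pi.add_apply]
  change x.fst k + Pi.single (M := fun _ : ℕ => Y) 0 (F.eval z x.snd) (k + 1) = _
  simp

end Canonical

end

noncomputable section

open MeasureTheory Filter Topology

/-! Dilation. `V(λ)` is block triangular, so the `H`-component of a product of values of `V` is the
same product of values of `T`, whatever the points. The identity `F*F = I - T*T` on the circle makes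
`V` isometric there.

Minimality. If the compression to `L ⊇ H` is isometric, then `L` is invariant under every `V(λ)`,
since a projection that preserves the norm of a vector fixes it. Dropping `H`-components leaves
`F(λ)h` in place `-1`. Averaging over `λ = ±1` gives `F₀h`, and an outer `F` has `F₀` of dense
range, because evaluation at `0` is bounded on `H²`. So `L` contains the whole place `-1`, and the
shift supplies the other places. Only isometry of the compression is used, so one argument serves
both notions of minimality.

Existence. Taylor coefficients identify `H²` with `ℓ²`, and multiplication by `T` becomes a
contraction `C` on `ℓ²(H)` commuting with the shift `S`. Choose `R` with dense range and `R*R = I -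
C*C`. Then `‖RSx‖ = ‖Rx‖`, so `MR = RS` for an isometry `M`. Put `Y = ker M*` and let `d` be `R` on
constants. Since `T` has degree one, `M*M*d = 0`, so `d = F₀ + M F₁` with `F₀ = (1 - MM*)d` and `F₁
= M*d`, both `Y`-valued. Inner products of `d` and `Md` give the coefficient form of the
factorization. Finally `‖c - Rx‖` equals the `ℓ²` distance from the constant `c ∈ Y` to `Fx`, so
density of the range of `R` makes `F` outer. -/

theorem integral_conj_circleMap_pow_mul (r : ℝ) (k j : ℕ) :
    ∫ s in (0 : ℝ)..2 * Real.pi,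
      (starRingEnd ℂ) (circleMap 0 r s) ^ k * circleMap 0 r s ^ j =
      if k = j then ((2 * Real.pi * (r ^ k) ^ 2 : ℝ) : ℂ) else 0 := by
  have key : ∀ s : ℝ, (starRingEnd ℂ) (circleMap 0 r s) ^ k * circleMap 0 r s ^ j =
      (r : ℂ) ^ k * (r : ℂ) ^ j * Complex.exp ((((j : ℂ) - k) * Complex.I) * s) := by
    intro s
    have h : (starRingEnd ℂ) (circleMap 0 r s) = r * Complex.exp (-(s * Complex.I)) := by
      simp [circleMap, ← Complex.exp_conj]
    rw [h, circleMap, zero_add, mul_pow, mul_pow, ← Complex.exp_nat_mul, ← Complex.exp_nat_mul,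
      mul_mul_mul_comm, ← Complex.exp_add]
    congr 2
    ring
  simp_rw [key]
  rw [intervalIntegral.integral_const_mul]
  split_ifs with h
  · subst h
    simp
    ring
  · have hc : ((j : ℂ) - k) * Complex.I ≠ 0 :=
      mul_ne_zero (sub_ne_zero.2 fun h' => h (by exact_mod_cast h'.symm)) Complex.I_ne_zero
    rw [integral_exp_mul_complex hc]
    have h1 : Complex.exp (((j : ℂ) - k) * Complex.I * (2 * Real.pi : ℝ)) = 1 := by
      rw [Complex.exp_eq_one_iff]
      exact ⟨(j : ℤ) - k, by push_cast; ring⟩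
    rw [h1]
    simp

/-! ### Parseval's identity for the Hardy norm -/

section Parseval

variable {E : Type u} [NormedAddCommGroup E] [InnerProductSpace ℂ E]

theorem continuous_sum_circleMap_pow_smul (a : ℕ → E) (r : ℝ) (N : ℕ) :
    Continuous fun s : ℝ => ∑ k ∈ Finset.range N, circleMap 0 r s ^ k • a k := by
  have := continuous_circleMap 0 r
  fun_prop

theorem integral_norm_sq_sum_circleMap_pow_smul (a : ℕ → E) (r : ℝ) (N : ℕ) :
    ∫ s in (0 : ℝ)..2 * Real.pi, ‖∑ k ∈ Finset.range N, circleMap 0 r s ^ k • a k‖ ^ 2 =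
      2 * Real.pi * ∑ k ∈ Finset.range N, (r ^ k) ^ 2 * ‖a k‖ ^ 2 := by
  have hcont := continuous_circleMap 0 r
  have key : ∀ s : ℝ, ((‖∑ k ∈ Finset.range N, circleMap 0 r s ^ k • a k‖ ^ 2 : ℝ) : ℂ) =
      ∑ k ∈ Finset.range N, ∑ j ∈ Finset.range N,
        ((starRingEnd ℂ) (circleMap 0 r s) ^ k * circleMap 0 r s ^ j) * inner ℂ (a k) (a j) := by
    intro s
    have h := inner_self_eq_norm_sq_to_K (𝕜 := ℂ) (∑ k ∈ Finset.range N, circleMap 0 r s ^ k • a k)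
    push_cast
    rw [← Complex.coe_algebraMap, ← h, sum_inner]
    refine Finset.sum_congr rfl fun k _ => ?_
    rw [inner_sum]
    refine Finset.sum_congr rfl fun j _ => ?_
    rw [inner_smul_left, inner_smul_right, map_pow, mul_assoc]
  apply Complex.ofReal_injective
  rw [← intervalIntegral.integral_ofReal]
  simp_rw [key]
  rw [intervalIntegral.integral_finsetSum]
  · have : ∀ k ∈ Finset.range N, ∫ s in (0 : ℝ)..2 * Real.pi, ∑ j ∈ Finset.range N,
        ((starRingEnd ℂ) (circleMap 0 r s) ^ k * circleMap 0 r s ^ j) * inner ℂ (a k) (a j) =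
        ((2 * Real.pi * (r ^ k) ^ 2 : ℝ) : ℂ) * (‖a k‖ ^ 2 : ℝ) := by
      intro k hk
      rw [intervalIntegral.integral_finsetSum]
      · simp_rw [intervalIntegral.integral_mul_const, integral_conj_circleMap_pow_mul]
        rw [Finset.sum_eq_single k]
        · rw [if_pos rfl, inner_self_eq_norm_sq_to_K]
          push_cast
          rfl
        · intro j _ hj
          rw [if_neg hj.symm, zero_mul]
        · exact fun h => absurd hk h
      · intro j _
        apply Continuous.intervalIntegrable
        have := Complex.continuous_conj
        fun_prop
    rw [Finset.sum_congr rfl this, Finset.mul_sum]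
    push_cast
    exact Finset.sum_congr rfl fun k _ => by ring
  · intro k _
    apply Continuous.intervalIntegrable
    have := Complex.continuous_conj
    fun_prop

theorem lintegral_enorm_sq_sum_circleMap_pow_smul (a : ℕ → E) {r : ℝ} (hr : 0 ≤ r) (N : ℕ) :
    ∫⁻ s in Set.Ioc 0 (2 * Real.pi), ‖∑ k ∈ Finset.range N, circleMap 0 r s ^ k • a k‖ₑ ^ 2 =
      ENNReal.ofReal (2 * Real.pi) *
        ∑ k ∈ Finset.range N, (ENNReal.ofReal r ^ k) ^ 2 * ‖a k‖ₑ ^ 2 := by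
  have h1 : ∀ s : ℝ, ‖∑ k ∈ Finset.range N, circleMap 0 r s ^ k • a k‖ₑ ^ 2 =
      ENNReal.ofReal (‖∑ k ∈ Finset.range N, circleMap 0 r s ^ k • a k‖ ^ 2) := fun s => by
    rw [ENNReal.ofReal_pow (norm_nonneg _), ofReal_norm]
  have hc := continuous_sum_circleMap_pow_smul a r N
  simp_rw [h1]
  rw [← ofReal_integral_eq_lintegral_ofReal, ← intervalIntegral.integral_of_le (by positivity),
    integral_norm_sq_sum_circleMap_pow_smul, ENNReal.ofReal_mul (by positivity),
    ENNReal.ofReal_sum_of_nonneg fun k _ => by positivity]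
  · congr 1
    refine Finset.sum_congr rfl fun k _ => ?_
    rw [ENNReal.ofReal_mul (by positivity), ENNReal.ofReal_pow (by positivity),
      ENNReal.ofReal_pow hr, ENNReal.ofReal_pow (norm_nonneg _), ofReal_norm]
  · exact ((hc.norm.pow 2).integrableOn_Icc).mono_set Set.Ioc_subset_Icc_self
  · exact Eventually.of_forall fun s => by positivity

/-- Convergence at a radius `ρ` strictly between `r` and `1` bounds `ρ ^ k * ‖a k‖`; the ratio `r /
ρ` then gives a geometric majorant. -/
theorem summable_pow_mul_norm_of_hasSum {a : ℕ → E} {g : ℂ → E}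
    (h : ∀ z ∈ Metric.ball (0 : ℂ) 1, HasSum (fun k => z ^ k • a k) (g z))
    {r : ℝ} (hr : r ∈ Set.Ioo (0 : ℝ) 1) : Summable fun k => r ^ k * ‖a k‖ := by
  obtain ⟨ρ, hrρ, hρ⟩ := exists_between hr.2
  have hρ0 : 0 < ρ := hr.1.trans hrρ
  have hs := (h (ρ : ℂ) (by simpa [abs_of_pos hρ0] using hρ)).summable.tendsto_atTop_zero
  obtain ⟨C, hC⟩ := hs.norm.bddAbove_range
  have hC' : ∀ k, ρ ^ k * ‖a k‖ ≤ C := fun k => by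
    have := hC ⟨k, rfl⟩
    simpa [norm_smul, abs_of_pos hρ0] using this
  refine Summable.of_nonneg_of_le (fun k => by have := hr.1; positivity) (fun k => ?_)
    ((summable_geometric_of_lt_one (by have := hr.1; positivity)
      ((div_lt_one hρ0).2 hrρ)).mul_left C)
  calc r ^ k * ‖a k‖ = (ρ ^ k * ‖a k‖) * (r / ρ) ^ k := by
        rw [div_pow]; field_simp
    _ ≤ C * (r / ρ) ^ k := by
        have := hr.1
        gcongr
        exact hC' k

/-- Orthogonality of the exponentials settles the partial sums, and dominated convergence passes to
the limit; the constant majorant is the square of the absolutely convergent sum on the circle. -/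
theorem lintegral_enorm_sq_circleMap {a : ℕ → E} {g : ℂ → E}
    (h : ∀ z ∈ Metric.ball (0 : ℂ) 1, HasSum (fun k => z ^ k • a k) (g z))
    {r : ℝ} (hr : r ∈ Set.Ioo (0 : ℝ) 1) :
    ∫⁻ s in Set.Ioc 0 (2 * Real.pi), ‖g (circleMap 0 r s)‖ₑ ^ 2 =
      ENNReal.ofReal (2 * Real.pi) * ∑' k, (ENNReal.ofReal r ^ k) ^ 2 * ‖a k‖ₑ ^ 2 := by
  have hsum := summable_pow_mul_norm_of_hasSum h hr
  have hnorm : ∀ s, ‖circleMap 0 r s‖ = r := fun s => by simp [abs_of_pos hr.1]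
  have hlim : Tendsto (fun N => ∫⁻ s in Set.Ioc 0 (2 * Real.pi),
      ‖∑ k ∈ Finset.range N, circleMap 0 r s ^ k • a k‖ₑ ^ 2) atTop
      (𝓝 (∫⁻ s in Set.Ioc 0 (2 * Real.pi), ‖g (circleMap 0 r s)‖ₑ ^ 2)) := by
    refine tendsto_lintegral_of_dominated_convergence
      (fun _ => ENNReal.ofReal (∑' k, r ^ k * ‖a k‖) ^ 2) (fun N => ?_) (fun N => ?_) ?_ ?_
    · exact (continuous_sum_circleMap_pow_smul a r N).enorm.measurable.pow_const 2
    · refine Eventually.of_forall fun s => ?_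
      dsimp only
      gcongr
      rw [← ofReal_norm]
      refine ENNReal.ofReal_le_ofReal ((norm_sum_le _ _).trans ?_)
      have : ∀ k ∈ Finset.range N, ‖circleMap 0 r s ^ k • a k‖ = r ^ k * ‖a k‖ := fun k _ => by
        rw [norm_smul, norm_pow, hnorm]
      rw [Finset.sum_congr rfl this]
      exact hsum.sum_le_tsum _ fun k _ => by have := hr.1; positivity
    · rw [lintegral_const]
      exact ENNReal.mul_ne_top (by simp) (by simp [ENNReal.mul_eq_top])
    · refine Eventually.of_forall fun s => ?_
      have := (h (circleMap 0 r s) (by simpa [hnorm] using hr.2)).tendsto_sum_nat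
      exact ((ENNReal.continuous_pow 2).tendsto _).comp this.enorm
  refine tendsto_nhds_unique hlim ?_
  simp_rw [lintegral_enorm_sq_sum_circleMap_pow_smul a hr.1.le]
  exact ENNReal.Tendsto.const_mul (ENNReal.tendsto_nat_tsum _) (Or.inr ENNReal.ofReal_ne_top)

/-- An identity in `[0, ∞]`, so it also decides membership in `H²`. Each circle gives at most the
full sum because `r < 1`. -/
theorem hardyNormSq_eq_tsum {a : ℕ → E} {g : ℂ → E}
    (h : ∀ z ∈ Metric.ball (0 : ℂ) 1, HasSum (fun k => z ^ k • a k) (g z)) :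
    hardyNormSq g = ∑' k, ‖a k‖ₑ ^ 2 := by
  have hpi : ENNReal.ofReal (2 * Real.pi)⁻¹ * ENNReal.ofReal (2 * Real.pi) = 1 := by
    rw [← ENNReal.ofReal_mul (by positivity), inv_mul_cancel₀ (by positivity), ENNReal.ofReal_one]
  have hsup : hardyNormSq g =
      ⨆ r ∈ Set.Ioo (0 : ℝ) 1, ∑' k, (ENNReal.ofReal r ^ k) ^ 2 * ‖a k‖ₑ ^ 2 := by
    rw [hardyNormSq, ENNReal.mul_iSup]
    refine iSup_congr fun r => ?_
    rw [ENNReal.mul_iSup]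
    refine iSup_congr fun hr => ?_
    rw [lintegral_enorm_sq_circleMap h hr, ← mul_assoc, hpi, one_mul]
  rw [hsup]
  refine le_antisymm (iSup₂_le fun r hr => ENNReal.tsum_le_tsum fun k => ?_) ?_
  · refine mul_le_of_le_one_left' (pow_le_one' (pow_le_one' ?_ _) _)
    exact ENNReal.ofReal_le_one.2 hr.2.le
  · rw [ENNReal.tsum_eq_iSup_sum]
    refine iSup_le fun s => ?_
    -- For the lower bound, let `r` increase to `1` in a finite partial sum, where the limit may be
    -- taken termwise.
    have hlim : Tendsto (fun r : ℝ => ∑ k ∈ s, (ENNReal.ofReal r ^ k) ^ 2 * ‖a k‖ₑ ^ 2)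
        (𝓝[<] 1) (𝓝 (∑ k ∈ s, ‖a k‖ₑ ^ 2)) := by
      have h0 : Tendsto (fun r : ℝ => ENNReal.ofReal r) (𝓝[<] 1) (𝓝 1) := by
        have := ENNReal.continuous_ofReal.tendsto 1
        rw [ENNReal.ofReal_one] at this
        exact this.mono_left nhdsWithin_le_nhds
      refine tendsto_finsetSum _ fun k _ => ?_
      have h1 := (ENNReal.continuous_pow 2).tendsto _ |>.comp
        (((ENNReal.continuous_pow k).tendsto _).comp h0)
      have h2 := ENNReal.Tendsto.mul_const (b := ‖a k‖ₑ ^ 2) h1 (Or.inr (by simp))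
      simpa using h2
    refine le_of_tendsto hlim ?_
    have hev : ∀ᶠ r : ℝ in 𝓝[<] 1, r ∈ Set.Ioo (0 : ℝ) 1 := Ioo_mem_nhdsLT one_pos
    filter_upwards [hev] with r hr
    exact (ENNReal.sum_le_tsum s).trans
      (le_iSup₂_of_le (f := fun (r : ℝ) (_ : r ∈ Set.Ioo (0 : ℝ) 1) =>
        ∑' k, (ENNReal.ofReal r ^ k) ^ 2 * ‖a k‖ₑ ^ 2) r hr le_rfl)

/-- A holomorphic function on the open unit disk is the sum of its Taylor series. -/
theorem exists_hasSum_of_differentiableOn [CompleteSpace E] {g : ℂ → E}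
    (hg : DifferentiableOn ℂ g (Metric.ball 0 1)) :
    ∃ a : ℕ → E, ∀ z ∈ Metric.ball (0 : ℂ) 1, HasSum (fun k => z ^ k • a k) (g z) := by
  refine ⟨fun k => ((k.factorial : ℂ)⁻¹) • iteratedDeriv k g 0, fun z hz => ?_⟩
  simpa only [sub_zero, smul_comm _ (z ^ _)] using Complex.hasSum_taylorSeries_on_ball hg hz

/-- The value at `0` is the zeroth Taylor coefficient, a single term of Parseval's sum. -/
theorem enorm_sq_apply_zero_le_hardyNormSq [CompleteSpace E] {g : ℂ → E}
    (hg : DifferentiableOn ℂ g (Metric.ball 0 1)) : ‖g 0‖ₑ ^ 2 ≤ hardyNormSq g := by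
  obtain ⟨a, ha⟩ := exists_hasSum_of_differentiableOn hg
  have h0 : g 0 = a 0 := by
    refine (ha 0 (by simp)).unique ?_
    convert hasSum_single (f := fun k => (0 : ℂ) ^ k • a k) 0 fun k hk => by simp [hk] using 1
    simp
  rw [hardyNormSq_eq_tsum ha, h0]
  exact ENNReal.le_tsum 0

end Parseval

/-! ### Values and compressions of linear pencils -/

namespace LinearPencil

variable {E : Type u} {F : Type v}
    [NormedAddCommGroup E] [InnerProductSpace ℂ E]
    [NormedAddCommGroup F] [InnerProductSpace ℂ F]

theorem eval_apply (A : LinearPencil E F) (z : ℂ) (x : E) :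
    A.eval z x = A.coeff0 x + z • A.coeff1 x := rfl

theorem eval_zero (A : LinearPencil E F) : A.eval 0 = A.coeff0 := by
  simp [eval]

theorem differentiable_eval (A : LinearPencil E F) : Differentiable ℂ A.eval := by
  unfold eval
  fun_prop

/-- The maximum modulus principle for operator-valued functions. -/
theorem norm_eval_le_one_of_mem_ball (A : LinearPencil E F)
    (h : ∀ ζ : ℂ, ‖ζ‖ = 1 → ‖A.eval ζ‖ ≤ 1) {z : ℂ} (hz : z ∈ Metric.ball (0 : ℂ) 1) :
    ‖A.eval z‖ ≤ 1 := by
  refine Complex.norm_le_of_forall_mem_frontier_norm_le Metric.isBounded_ball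
    (A.differentiable_eval.diffContOnCl) (fun ζ hζ => h ζ ?_) (subset_closure hz)
  rw [frontier_ball _ one_ne_zero] at hζ
  simpa using hζ

theorem compress_eval_apply {K : Type w} [NormedAddCommGroup K] [InnerProductSpace ℂ K]
    (A : LinearPencil K K) (L : Submodule ℂ K) [CompleteSpace L] (z : ℂ) (x : L) :
    (A.compress L).eval z x = L.orthogonalProjectionOnto (A.eval z x) := by
  simp [eval_apply, compress]

end LinearPencil

/-! ### The shift on square summable sequences -/

section Sequences

theorem hasSum_norm_sq_lp_two {Y : Type v} [NormedAddCommGroup Y] (y : lp (fun _ : ℕ => Y) 2) :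
    HasSum (fun k => ‖y k‖ ^ 2) (‖y‖ ^ 2) := by
  simpa using lp.hasSum_norm (p := 2) (by norm_num) y

variable {Y : Type v} [NormedAddCommGroup Y] [InnerProductSpace ℂ Y]

theorem shift_apply_zero (y : lp (fun _ : ℕ => Y) 2) : shift Y y 0 = 0 := rfl

theorem shift_apply_succ (y : lp (fun _ : ℕ => Y) 2) (k : ℕ) : shift Y y (k + 1) = y k := rfl

theorem lastComponent_apply_zero (c : Y) : lastComponent Y c 0 = c :=
  lp.single_apply_self (E := fun _ : ℕ => Y) 2 0 c

theorem lastComponent_apply_succ (c : Y) (k : ℕ) : lastComponent Y c (k + 1) = 0 :=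
  lp.single_apply_ne (E := fun _ : ℕ => Y) 2 0 c (Nat.succ_ne_zero k)

theorem shift_single (k : ℕ) (c : Y) :
    shift Y (lp.single (E := fun _ : ℕ => Y) 2 k c) = lp.single 2 (k + 1) c := by
  ext j
  cases j with
  | zero => exact (lp.single_apply_ne (E := fun _ : ℕ => Y) 2 (k + 1) c k.succ_ne_zero.symm).symm
  | succ j => simp [shift_apply_succ, lp.single_apply, Pi.single_apply]

/-- The two summands have disjoint supports: the shift vacates place `0`, which `c` fills. -/
theorem norm_sq_shift_add_lastComponent (y : lp (fun _ : ℕ => Y) 2) (c : Y) :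
    ‖shift Y y + lastComponent Y c‖ ^ 2 = ‖y‖ ^ 2 + ‖c‖ ^ 2 := by
  have h := hasSum_norm_sq_lp_two (shift Y y + lastComponent Y c)
  rw [← hasSum_nat_add_iff' 1] at h
  have h1 : HasSum (fun k => ‖(shift Y y + lastComponent Y c) (k + 1)‖ ^ 2) (‖y‖ ^ 2) := by
    simpa [lp.coeFn_add, shift_apply_succ, lastComponent_apply_succ] using hasSum_norm_sq_lp_two y
  have h2 := h.unique h1
  simp [shift_apply_zero, lastComponent_apply_zero] at h2
  linarith

end Sequences

/-! ### The canonical pencil: dilation property and minimality -/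

section Dilation

variable {H : Type u} [NormedAddCommGroup H] [InnerProductSpace ℂ H] [CompleteSpace H]
  {Y : Type v} [NormedAddCommGroup Y] [InnerProductSpace ℂ Y] [CompleteSpace Y]

theorem adjoint_embedKPlus_apply (x : KPlus Y H) :
    adjoint (embedKPlus Y H).toContinuousLinearMap x = x.snd := by
  refine ext_inner_left ℂ fun h => ?_
  rw [adjoint_inner_right]
  simp [embedKPlus, WithLp.prod_inner_apply]

/-- The `H`-component of the image depends only on the `H`-component of the argument, so words
multiply there; the points need not lie on the circle. -/
theorem map_eval_prod_eq_adjoint_embedKPlus (T : LinearPencil H H) (F : LinearPencil H Y)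
    (l : List ℂ) :
    (l.map T.eval).prod = adjoint (embedKPlus Y H).toContinuousLinearMap ∘L
      (l.map (canonicalPencil T F).eval).prod ∘L (embedKPlus Y H).toContinuousLinearMap := by
  ext h
  simp only [comp_apply, adjoint_embedKPlus_apply]
  induction l with
  | nil => simp [embedKPlus]
  | cons z l ih =>
    rw [List.map_cons, List.prod_cons, List.map_cons, List.prod_cons, mul_def, mul_def,
      comp_apply, comp_apply, canonicalPencil_eval_snd, ih]

theorem isUniformDilation_canonicalPencil (T : LinearPencil H H) (F : LinearPencil H Y) :
    IsUniformDilation (embedKPlus Y H) T (canonicalPencil T F) := by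
  refine ⟨fun ζ _ n => ?_, fun l _ => map_eval_prod_eq_adjoint_embedKPlus T F l⟩
  simpa using map_eval_prod_eq_adjoint_embedKPlus T F (List.replicate n ζ)

theorem norm_sq_eval_of_factor {T : LinearPencil H H} {F : LinearPencil H Y} {ζ : ℂ}
    (h : adjoint (F.eval ζ) ∘L F.eval ζ =
      ContinuousLinearMap.id ℂ H - adjoint (T.eval ζ) ∘L T.eval ζ) (x : H) :
    ‖F.eval ζ x‖ ^ 2 = ‖x‖ ^ 2 - ‖T.eval ζ x‖ ^ 2 := by
  rw [apply_norm_sq_eq_inner_adjoint_right, apply_norm_sq_eq_inner_adjoint_right (T.eval ζ), h,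
    sub_apply, inner_sub_right, map_sub, id_apply, inner_self_eq_norm_sq]

theorem isIsometric_canonicalPencil {T : LinearPencil H H} {F : LinearPencil H Y}
    (h : ∀ ζ : ℂ, ‖ζ‖ = 1 → adjoint (F.eval ζ) ∘L F.eval ζ =
      ContinuousLinearMap.id ℂ H - adjoint (T.eval ζ) ∘L T.eval ζ) :
    (canonicalPencil T F).IsIsometric := by
  intro ζ hζ x
  rw [← sq_eq_sq₀ (norm_nonneg _) (norm_nonneg _), WithLp.prod_norm_sq_eq_of_L2,
    WithLp.prod_norm_sq_eq_of_L2, canonicalPencil_eval_fst, canonicalPencil_eval_snd,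
    norm_sq_shift_add_lastComponent, norm_sq_eval_of_factor (h ζ hζ)]
  ring

/-- The value at `0` of an outer function has dense range. -/
theorem IsOuter.denseRange_apply_zero {X : Type u} [NormedAddCommGroup X] [NormedSpace ℂ X]
    {θ : ℂ → X →L[ℂ] Y} (hθ : IsOuter θ) :
    DenseRange (θ 0) := by
  intro c
  rw [Metric.mem_closure_iff]
  intro ε hε
  have hc : ∀ z ∈ Metric.ball (0 : ℂ) 1,
      HasSum (fun k => z ^ k • (Pi.single 0 c : ℕ → Y) k) c := fun z _ => by
    convert hasSum_single (f := fun k => z ^ k • (Pi.single 0 c : ℕ → Y) k) 0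
      fun k hk => by simp [hk] using 1
    simp
  have hmem : MemHardy fun _ : ℂ => c := by
    refine ⟨differentiableOn_const c, ?_⟩
    rw [hardyNormSq_eq_tsum (g := fun _ => c) hc, tsum_eq_single 0 fun k hk => by simp [hk]]
    simp
  -- Approximate the constant function `c` in `H²`; evaluating the error at `0` only decreases its
  -- norm.
  obtain ⟨x, hx, hlt⟩ := hθ.2.2 _ hmem (ENNReal.ofReal ε ^ 2) (by positivity)
  refine ⟨θ 0 (x 0), ⟨x 0, rfl⟩, ?_⟩
  have hd : DifferentiableOn ℂ (fun z => c - θ z (x z)) (Metric.ball 0 1) :=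
    (differentiableOn_const c).sub (hθ.1.clm_apply hx.1)
  have h := (enorm_sq_apply_zero_le_hardyNormSq hd).trans_lt hlt
  rw [ENNReal.pow_lt_pow_left_iff two_ne_zero, ← ofReal_norm,
    ENNReal.ofReal_lt_ofReal_iff hε] at h
  rwa [dist_eq_norm]

/-- A compression of an isometric pencil which is isometric is a restriction. -/
theorem LinearPencil.IsIsometric.eval_mem_of_compress {K : Type w} [NormedAddCommGroup K]
    [InnerProductSpace ℂ K] {S : LinearPencil K K} (hS : S.IsIsometric)
    {L : Submodule ℂ K} [CompleteSpace L] (hL : (S.compress L).IsIsometric) {ζ : ℂ} (hζ : ‖ζ‖ = 1)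
    {x : K} (hx : x ∈ L) : S.eval ζ x ∈ L := by
  -- The projection of `S(ζ)x` to `L` has norm `‖x‖ = ‖S(ζ)x‖`, which forces `S(ζ)x` into `L`.
  rw [L.mem_iff_norm_starProjection, hS ζ hζ]
  have := hL ζ hζ ⟨x, hx⟩
  rw [LinearPencil.compress_eval_apply] at this
  exact this

theorem eq_top_of_isIsometric_compress_canonicalPencil {T : LinearPencil H H}
    {F : LinearPencil H Y} (hF : IsOuterFactor T F) (L : Submodule ℂ (KPlus Y H)) [CompleteSpace L]
    (hHL : ∀ h : H, embedKPlus Y H h ∈ L) (hL : ((canonicalPencil T F).compress L).IsIsometric) :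
    L = ⊤ := by
  have hclosed : IsClosed (L : Set (KPlus Y H)) := (completeSpace_coe_iff_isComplete.1 ‹_›).isClosed
  have hinv : ∀ ζ : ℂ, ‖ζ‖ = 1 → ∀ x ∈ L, (canonicalPencil T F).eval ζ x ∈ L := fun ζ hζ x hx =>
    (isIsometric_canonicalPencil hF.2).eval_mem_of_compress hL hζ hx
  let J : lp (fun _ : ℕ => Y) 2 →ₗᵢ[ℂ] KPlus Y H :=
    { toFun := fun y => WithLp.toLp 2 (y, 0)
      map_add' := fun y y' => by rw [← WithLp.toLp_add]; simp
      map_smul' := fun c y => by rw [RingHom.id_apply, ← WithLp.toLp_smul]; simp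
      norm_map' := fun y => WithLp.norm_toLp_fst 2 _ H y }
  have hJ : ∀ y h, WithLp.toLp 2 (y, h) = J y + embedKPlus Y H h := fun y h => by
    change _ = WithLp.toLp 2 (y, 0) + WithLp.toLp 2 (0, h)
    rw [← WithLp.toLp_add]
    simp
  have hJL : ∀ y h, WithLp.toLp 2 (y, h) ∈ L → J y ∈ L := fun y h hy => by
    rw [hJ] at hy
    exact (L.add_mem_iff_left (hHL h)).1 hy
  have hshift : ∀ y, J y ∈ L → J (shift Y y) ∈ L := fun y hy => by
    have h1 := hinv 1 (by simp) _ hy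
    have h2 : (canonicalPencil T F).eval 1 (J y) = J (shift Y y) := by
      apply (WithLp.ofLp_injective 2)
      refine Prod.ext ?_ ?_
      · refine (canonicalPencil_eval_fst T F 1 (J y)).trans ?_
        simp [J]
      · refine (canonicalPencil_eval_snd T F 1 (J y)).trans ?_
        simp [J]
    rwa [h2] at h1
  have heval : ∀ ζ : ℂ, ‖ζ‖ = 1 → ∀ h, J (lastComponent Y (F.eval ζ h)) ∈ L := fun ζ hζ h => by
    have h1 := hinv ζ hζ _ (hHL h)
    refine hJL _ (T.eval ζ h) ?_
    convert h1 using 1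
    apply (WithLp.ofLp_injective 2)
    refine Prod.ext ?_ ?_
    · refine Eq.trans ?_ (canonicalPencil_eval_fst T F ζ _).symm
      simp [embedKPlus]
    · refine Eq.trans ?_ (canonicalPencil_eval_snd T F ζ _).symm
      simp [embedKPlus]
  -- Invariance is known only on the circle; `F₀`, the value at `0`, is the mean of the values at
  -- `1` and `-1`.
  have hF0 : ∀ h, J (lastComponent Y (F.coeff0 h)) ∈ L := fun h => by
    have h1 := heval 1 (by simp) h
    have h2 := heval (-1) (by simp) h
    have h3 : F.coeff0 h = (2⁻¹ : ℂ) • (F.eval 1 h + F.eval (-1) h) := by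
      rw [LinearPencil.eval_apply, LinearPencil.eval_apply]
      module
    rw [h3, map_smul, map_smul, map_add, map_add]
    exact L.smul_mem _ (L.add_mem h1 h2)
  have hlast : ∀ c, J (lastComponent Y c) ∈ L := fun c => by
    have hdense : DenseRange F.coeff0 := by
      have := hF.1.denseRange_apply_zero
      rwa [LinearPencil.eval_zero] at this
    refine hdense.induction_on (p := fun c => J (lastComponent Y c) ∈ L) c ?_ hF0
    exact hclosed.preimage (J.continuous.comp (lastComponent Y).continuous)
  have hsingle : ∀ k c, J (lp.single 2 k c) ∈ L := fun k c => by
    induction k with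
    | zero => exact hlast c
    | succ k ih =>
      rw [← shift_single]
      exact hshift _ ih
  have hall : ∀ y, J y ∈ L := fun y => by
    have h1 := (lp.hasSum_single (E := fun _ : ℕ => Y) (p := 2) (by simp) y).map J J.continuous
    exact hclosed.mem_of_tendsto h1 (Eventually.of_forall fun s => L.sum_mem fun k _ => hsingle k _)
  rw [eq_top_iff]
  intro x _
  have := L.add_mem (hall x.fst) (hHL x.snd)
  rwa [← hJ] at this

theorem isMinimal_canonicalPencil {T : LinearPencil H H} (hT : T.IsContractive)
    {F : LinearPencil H Y} (hF : IsOuterFactor T F) :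
    IsMinimalIsometricDilation (embedKPlus Y H) T (canonicalPencil T F) ∧
      IsMinimalUniformIsometricDilation (embedKPlus Y H) T (canonicalPencil T F) := by
  have hiso := isIsometric_canonicalPencil hF.2
  have hdil := isUniformDilation_canonicalPencil T F
  refine ⟨⟨⟨hT, hiso, hdil.1⟩, fun L _ κ hκ hL => ?_⟩, ⟨hT, hiso, hdil⟩, fun L _ κ hκ hL => ?_⟩ <;>
  exact eq_top_of_isIsometric_compress_canonicalPencil hF L (fun h => hκ h ▸ (κ h).2) hL.2.1

end Dilation

/-! ### Analytic Toeplitz operators and outer pencils -/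

section Toeplitz

variable {E : Type u} {F : Type v}
    [NormedAddCommGroup E] [InnerProductSpace ℂ E]
    [NormedAddCommGroup F] [InnerProductSpace ℂ F]

theorem memℓp_two_of_summable {E : Type u} [NormedAddCommGroup E] {a : ℕ → E}
    (h : Summable fun k => ‖a k‖ ^ 2) : Memℓp a 2 :=
  memℓp_gen (by simpa using h)

/-- The entrywise action of a bounded operator on square summable sequences. -/
def l2Map (A : E →L[ℂ] F) : lp (fun _ : ℕ => E) 2 →L[ℂ] lp (fun _ : ℕ => F) 2 :=
  have hle : ∀ (x : lp (fun _ : ℕ => E) 2) k, ‖A (x k)‖ ^ 2 ≤ ‖A‖ ^ 2 * ‖x k‖ ^ 2 := fun x k => by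
    rw [← mul_pow]
    gcongr
    exact A.le_opNorm _
  have hmem : ∀ x : lp (fun _ : ℕ => E) 2, Memℓp (fun k => A (x k)) 2 := fun x =>
    memℓp_two_of_summable (Summable.of_nonneg_of_le (fun k => by positivity) (hle x)
      ((hasSum_norm_sq_lp_two x).summable.mul_left _))
  LinearMap.mkContinuous
    { toFun := fun x => (⟨fun k => A (x k), hmem x⟩ : lp (fun _ : ℕ => F) 2)
      map_add' := fun x y => by ext k; exact map_add A (x k) (y k)
      map_smul' := fun c x => by ext k; exact map_smul A c (x k) } ‖A‖ fun x => by
    refine (sq_le_sq₀ (norm_nonneg _) (by positivity)).1 ?_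
    rw [mul_pow]
    exact hasSum_le (hle x) (hasSum_norm_sq_lp_two ⟨fun k => A (x k), hmem x⟩)
      ((hasSum_norm_sq_lp_two x).mul_left _)

namespace LinearPencil

/-- The analytic Toeplitz operator of a linear pencil: multiplication by the pencil in terms of
the Taylor coefficients. -/
def toeplitz (A : LinearPencil E F) : lp (fun _ : ℕ => E) 2 →L[ℂ] lp (fun _ : ℕ => F) 2 :=
  l2Map A.coeff0 + (shift F).toContinuousLinearMap ∘L l2Map A.coeff1

variable (A : LinearPencil E F) (x : lp (fun _ : ℕ => E) 2)

theorem toeplitz_apply_zero : A.toeplitz x 0 = A.coeff0 (x 0) := by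
  change A.coeff0 (x 0) + 0 = _
  rw [add_zero]

theorem toeplitz_apply_succ (k : ℕ) :
    A.toeplitz x (k + 1) = A.coeff0 (x (k + 1)) + A.coeff1 (x k) := rfl

theorem toeplitz_shift : A.toeplitz (shift E x) = shift F (A.toeplitz x) := by
  ext k
  cases k with
  | zero => simp [toeplitz_apply_zero, shift_apply_zero]
  | succ k =>
    rw [toeplitz_apply_succ, shift_apply_succ, shift_apply_succ]
    cases k with
    | zero => simp [toeplitz_apply_zero, shift_apply_zero]
    | succ k => rw [toeplitz_apply_succ, shift_apply_succ]

/-- This ties the operator on coefficients to pointwise multiplication by the pencil. -/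
theorem hasSum_toeplitz {z : ℂ} {g : E} (h : HasSum (fun k => z ^ k • x k) g) :
    HasSum (fun k => z ^ k • A.toeplitz x k) (A.eval z g) := by
  have h0 := h.mapL A.coeff0
  have h1 := (h.mapL A.coeff1).const_smul z
  rw [← hasSum_nat_add_iff' 1] at h0 ⊢
  convert h0.add h1 using 1
  · ext k
    simp [toeplitz_apply_succ, pow_succ', mul_smul, smul_add]
  · simp [toeplitz_apply_zero, eval_apply]
    abel

end LinearPencil

theorem ofReal_norm_sq_lp_two {E : Type u} [NormedAddCommGroup E] (x : lp (fun _ : ℕ => E) 2) :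
    ENNReal.ofReal (‖x‖ ^ 2) = ∑' k, ‖x k‖ₑ ^ 2 := by
  rw [← (hasSum_norm_sq_lp_two x).tsum_eq,
    ENNReal.ofReal_tsum_of_nonneg (fun k => by positivity) (hasSum_norm_sq_lp_two x).summable]
  refine tsum_congr fun k => ?_
  rw [ENNReal.ofReal_pow (norm_nonneg _), ofReal_norm]

theorem summable_pow_mul_norm_lp_two {E : Type u} [NormedAddCommGroup E]
    (x : lp (fun _ : ℕ => E) 2) {r : ℝ} (h0 : 0 ≤ r) (h1 : r < 1) :
    Summable fun k => r ^ k * ‖x k‖ :=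
  Summable.of_nonneg_of_le (fun k => by positivity)
    (fun k => mul_le_mul_of_nonneg_left (lp.norm_apply_le_norm two_ne_zero x k) (by positivity))
    ((summable_geometric_of_lt_one h0 h1).mul_right ‖x‖)

theorem hasSum_powerSeries_lp_two [CompleteSpace E] (x : lp (fun _ : ℕ => E) 2) {z : ℂ}
    (hz : z ∈ Metric.ball (0 : ℂ) 1) :
    HasSum (fun k => z ^ k • x k) (∑' k, z ^ k • x k) := by
  refine Summable.hasSum (Summable.of_norm ?_)
  simpa [norm_smul] using summable_pow_mul_norm_lp_two x (norm_nonneg z) (by simpa using hz)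

theorem memHardy_powerSeries_lp_two [CompleteSpace E] (x : lp (fun _ : ℕ => E) 2) :
    MemHardy fun z : ℂ => ∑' k, z ^ k • x k := by
  constructor
  · intro z hz
    obtain ⟨r, hzr, hr⟩ := exists_between (show ‖z‖ < 1 by simpa using hz)
    have hr0 := (norm_nonneg z).trans_lt hzr
    have h := Complex.differentiableOn_tsum_of_summable_norm (F := fun k (z : ℂ) => z ^ k • x k)
      (U := Metric.ball 0 r) (summable_pow_mul_norm_lp_two x hr0.le hr)
      (fun k => by fun_prop) Metric.isOpen_ball (fun k w hw => by
        rw [norm_smul, norm_pow]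
        have : ‖w‖ < r := by simpa using hw
        gcongr)
    exact (h.differentiableAt (Metric.isOpen_ball.mem_nhds (by simpa using hzr)))
      |>.differentiableWithinAt
  · rw [hardyNormSq_eq_tsum fun z hz => hasSum_powerSeries_lp_two x hz, ← ofReal_norm_sq_lp_two]
    exact ENNReal.ofReal_lt_top

/-- The pencil is contractive inside the disk, so it decreases the integral over each circle of
radius less than `1`; Parseval turns this into `ℓ²` norms without boundary values. -/
theorem LinearPencil.norm_toeplitz_apply_le [CompleteSpace E] (A : LinearPencil E F)
    (h : ∀ ζ : ℂ, ‖ζ‖ = 1 → ‖A.eval ζ‖ ≤ 1) (x : lp (fun _ : ℕ => E) 2) :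
    ‖A.toeplitz x‖ ≤ ‖x‖ := by
  have h1 : hardyNormSq (fun z => A.eval z (∑' k, z ^ k • x k)) ≤
      hardyNormSq (fun z : ℂ => ∑' k, z ^ k • x k) := by
    unfold hardyNormSq
    gcongr with r hr s
    have hle : ∀ v, ‖A.eval (circleMap 0 r s) v‖ ≤ ‖v‖ := fun v =>
      (A.eval _).le_of_opNorm_le_of_le (A.norm_eval_le_one_of_mem_ball h
        (by simpa [abs_of_pos hr.1] using hr.2)) le_rfl |>.trans_eq (one_mul _)
    exact enorm_le_iff_norm_le.2 (hle _)
  rw [hardyNormSq_eq_tsum fun z hz => A.hasSum_toeplitz x (hasSum_powerSeries_lp_two x hz),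
    hardyNormSq_eq_tsum fun z hz => hasSum_powerSeries_lp_two x hz, ← ofReal_norm_sq_lp_two,
    ← ofReal_norm_sq_lp_two, ENNReal.ofReal_le_ofReal_iff (by positivity)] at h1
  exact (sq_le_sq₀ (norm_nonneg _) (norm_nonneg _)).1 h1

theorem MemHardy.exists_lp_two [CompleteSpace E] {g : ℂ → E} (hg : MemHardy g) :
    ∃ x : lp (fun _ : ℕ => E) 2, ∀ z ∈ Metric.ball (0 : ℂ) 1,
      HasSum (fun k => z ^ k • x k) (g z) := by
  obtain ⟨a, ha⟩ := exists_hasSum_of_differentiableOn hg.1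
  have hfin := hg.2
  rw [hardyNormSq_eq_tsum ha] at hfin
  refine ⟨⟨a, memℓp_two_of_summable ?_⟩, ha⟩
  have := ENNReal.summable_toReal hfin.ne
  simpa using this

/-- A pencil which is contractive on the circle and whose Toeplitz operator has dense range is
outer. -/
theorem LinearPencil.isOuter_of_denseRange_toeplitz [CompleteSpace E] [CompleteSpace F]
    (A : LinearPencil E F) (h : ∀ ζ : ℂ, ‖ζ‖ = 1 → ‖A.eval ζ‖ ≤ 1) (hd : DenseRange A.toeplitz) :
    IsOuter A.eval := by
  refine ⟨A.differentiable_eval.differentiableOn,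
    fun z hz => A.norm_eval_le_one_of_mem_ball h hz, fun y hy ε hε => ?_⟩
  obtain ⟨b, hb⟩ := hy.exists_lp_two
  have hcont : Continuous fun c : lp (fun _ : ℕ => F) 2 => ENNReal.ofReal (‖b - c‖ ^ 2) :=
    ENNReal.continuous_ofReal.comp (by fun_prop)
  obtain ⟨x, hx⟩ := hd.exists_mem_open (isOpen_Iio.preimage hcont) ⟨b, by simpa using hε⟩
  refine ⟨fun z => ∑' k, z ^ k • x k, memHardy_powerSeries_lp_two x, ?_⟩
  rw [hardyNormSq_eq_tsum (a := fun k => (b - A.toeplitz x) k), ← ofReal_norm_sq_lp_two]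
  · exact hx
  · intro z hz
    simpa [smul_sub] using (hb z hz).sub (A.hasSum_toeplitz x (hasSum_powerSeries_lp_two x hz))

end Toeplitz

/-! ### Spectral factorization from the defect operator -/

section Factorization

/-- A contraction `C` has a defect operator: an operator `R` with dense range such that
`R* R = 1 - C* C`. -/
theorem exists_defect_operator {K : Type u} [NormedAddCommGroup K] [InnerProductSpace ℂ K]
    [CompleteSpace K] {K' : Type v} [NormedAddCommGroup K'] [InnerProductSpace ℂ K']
    [CompleteSpace K'] (C : K →L[ℂ] K') (hC : ∀ x, ‖C x‖ ≤ ‖x‖) :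
    ∃ (E : Type u) (_ : NormedAddCommGroup E) (_ : InnerProductSpace ℂ E) (_ : CompleteSpace E)
      (R : K →L[ℂ] E), DenseRange R ∧
        ∀ x y, inner ℂ (R x) (R y) = inner ℂ x y - inner ℂ (C x) (C y) := by
  let Q : K →L[ℂ] K := ContinuousLinearMap.id ℂ K - adjoint C ∘L C
  have hQ : 0 ≤ Q := by
    rw [nonneg_iff_isPositive, isPositive_iff_complex]
    intro x
    have h : inner ℂ (Q x) x = ((‖x‖ ^ 2 - ‖C x‖ ^ 2 : ℝ) : ℂ) := by
      simp only [Q, sub_apply, id_apply, comp_apply, inner_sub_left, adjoint_inner_left]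
      rw [inner_self_eq_norm_sq_to_K, inner_self_eq_norm_sq_to_K]
      push_cast
      rfl
    rw [h]
    refine ⟨by rw [RCLike.re_to_complex, Complex.ofReal_re], ?_⟩
    rw [RCLike.re_to_complex, Complex.ofReal_re]
    have := hC x
    nlinarith [norm_nonneg (C x)]
  -- The positive square root of `1 - C*C`; its range becomes dense once the codomain is cut down to
  -- the closure.
  let R : K →L[ℂ] K := CFC.sqrt Q
  have hR : ∀ x y, inner ℂ (R x) (R y) = inner ℂ x y - inner ℂ (C x) (C y) := fun x y => by
    have hsa : adjoint R = R := (IsSelfAdjoint.of_nonneg (CFC.sqrt_nonneg Q)).adjoint_eq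
    have hRR : R (R y) = Q y := DFunLike.congr_fun (CFC.sqrt_mul_sqrt_self Q hQ) y
    rw [← adjoint_inner_right, hsa, hRR]
    simp [Q, inner_sub_right, adjoint_inner_right]
  let L := R.range.topologicalClosure
  have hmem : ∀ x, R x ∈ L := fun x => R.range.le_topologicalClosure ⟨x, rfl⟩
  refine ⟨L, inferInstance, inferInstance, inferInstance, R.codRestrict L hmem, ?_,
    fun x y => hR x y⟩
  intro y
  rw [closure_subtype]
  have : ((↑) '' Set.range (R.codRestrict L hmem) : Set K) = Set.range R := by
    rw [← Set.range_comp]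
    rfl
  rw [this]
  exact y.2

/-- An operator on a dense range which preserves norms extends to an isometry. -/
theorem exists_isometry_comp_eq {K : Type u} [NormedAddCommGroup K] [InnerProductSpace ℂ K]
    {E : Type v} [NormedAddCommGroup E] [InnerProductSpace ℂ E] [CompleteSpace E]
    (R : K →L[ℂ] E) (hR : DenseRange R) (S : K →L[ℂ] K) (hS : ∀ x, ‖R (S x)‖ = ‖R x‖) :
    ∃ M : E →L[ℂ] E, (∀ x, M (R x) = R (S x)) ∧ ∀ e, adjoint M (M e) = e := by
  let M : E →L[ℂ] E := (R ∘L S).toLinearMap.extendOfNorm R.toLinearMap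
  have hM : ∀ x, M (R x) = R (S x) := fun x =>
    LinearMap.extendOfNorm_eq (f := (R ∘L S).toLinearMap) (e := R.toLinearMap) hR
      ⟨1, fun x => by simpa using (hS x).le⟩ x
  have hnorm : ∀ e, ‖M e‖ = ‖e‖ := fun e =>
    hR.induction_on (p := fun e => ‖M e‖ = ‖e‖) e
      (isClosed_eq (by fun_prop) (by fun_prop)) fun x => by rw [hM, hS]
  exact ⟨M, hM, fun e => DFunLike.congr_fun ((norm_map_iff_adjoint_comp_self M).1 hnorm) e⟩

variable {H : Type u} [NormedAddCommGroup H] [InnerProductSpace ℂ H]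

theorem shift_add_lastComponent_surjective (x : lp (fun _ : ℕ => H) 2) :
    ∃ x' : lp (fun _ : ℕ => H) 2, x = lastComponent H (x 0) + shift H x' := by
  refine ⟨⟨fun k => x (k + 1), memℓp_two_of_summable ?_⟩, ?_⟩
  · exact (summable_nat_add_iff 1).2 (hasSum_norm_sq_lp_two x).summable
  · ext k
    cases k with
    | zero => simp [lastComponent_apply_zero, shift_apply_zero]
    | succ k => simp [lastComponent_apply_succ, shift_apply_succ]

theorem inner_shift_shift (x y : lp (fun _ : ℕ => H) 2) :
    inner ℂ (shift H x) (shift H y) = inner ℂ x y := (shift H).inner_map_map x y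

theorem inner_lastComponent_left (h : H) (y : lp (fun _ : ℕ => H) 2) :
    inner ℂ (lastComponent H h) y = inner ℂ h (y 0) :=
  lp.inner_single_left (𝕜 := ℂ) (G := fun _ : ℕ => H) 0 h y

theorem inner_shift_lastComponent (x : lp (fun _ : ℕ => H) 2) (h : H) :
    inner ℂ (shift H x) (lastComponent H h) = 0 := by
  rw [← inner_conj_symm, inner_lastComponent_left, shift_apply_zero, inner_zero_right, map_zero]

theorem LinearPencil.toeplitz_lastComponent {Y : Type v} [NormedAddCommGroup Y]
    [InnerProductSpace ℂ Y] (A : LinearPencil H Y) (h : H) :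
    A.toeplitz (lastComponent H h) =
      lastComponent Y (A.coeff0 h) + shift Y (lastComponent Y (A.coeff1 h)) := by
  ext k
  rcases k with _ | _ | k
  · simp [toeplitz_apply_zero, lastComponent_apply_zero, shift_apply_zero]
  · simp [toeplitz_apply_succ, lastComponent_apply_zero, lastComponent_apply_succ, shift_apply_succ]
  · simp [toeplitz_apply_succ, lastComponent_apply_succ, shift_apply_succ]

variable [CompleteSpace H]

/-- Coefficient form of the factorization of a nonnegative trigonometric polynomial of degree one:
`F₀* F₀ + F₁* F₁ = 1 - T₀* T₀ - T₁* T₁` and `F₁* F₀ = - T₁* T₀`, together with an extremality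
property of `F₀`. -/
theorem exists_extremal_factor (T : LinearPencil H H) (hT : T.IsContractive) :
    ∃ (Y : Type u) (_ : NormedAddCommGroup Y) (_ : InnerProductSpace ℂ Y) (_ : CompleteSpace Y)
      (F : LinearPencil H Y), DenseRange F.coeff0 ∧
      (∀ h k, inner ℂ (F.coeff0 h) (F.coeff0 k) + inner ℂ (F.coeff1 h) (F.coeff1 k) =
        inner ℂ h k - inner ℂ (T.coeff0 h) (T.coeff0 k) - inner ℂ (T.coeff1 h) (T.coeff1 k)) ∧
      (∀ h k, inner ℂ (F.coeff1 h) (F.coeff0 k) = - inner ℂ (T.coeff1 h) (T.coeff0 k)) ∧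
      ∀ (c : Y) (ε : ℝ), 0 < ε → ∃ x : lp (fun _ : ℕ => H) 2,
        ‖x‖ ^ 2 - ‖T.toeplitz x‖ ^ 2 - 2 * (inner ℂ c (F.coeff0 (x 0))).re + ‖c‖ ^ 2 < ε := by
  obtain ⟨E, _, _, _, R, hRd, hR⟩ := exists_defect_operator T.toeplitz (T.norm_toeplitz_apply_le hT)
  have hRn : ∀ x, ‖R x‖ ^ 2 = ‖x‖ ^ 2 - ‖T.toeplitz x‖ ^ 2 := fun x => by
    have h := hR x x
    simp only [inner_self_eq_norm_sq_to_K] at h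
    exact_mod_cast h
  -- The Toeplitz operator commutes with the isometric shift, so `‖x‖² - ‖Cx‖²` does not change
  -- under the shift.
  obtain ⟨M, hM, hMM⟩ := exists_isometry_comp_eq R hRd (shift H).toContinuousLinearMap fun x => by
    rw [← sq_eq_sq₀ (norm_nonneg _) (norm_nonneg _), hRn, hRn]
    simp [LinearPencil.toeplitz_shift]
  replace hM : ∀ x, M (R x) = R (shift H x) := hM
  let d : H →L[ℂ] E := R ∘L (lastComponent H).toContinuousLinearMap
  have hd : ∀ h, d h = R (lastComponent H h) := fun _ => rfl
  -- Degree one enters here: `C` maps constants into places `0` and `1`, which are orthogonal to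
  -- twice shifted sequences.
  have hMMd : ∀ h, adjoint M (adjoint M (d h)) = 0 := fun h => by
    refine hRd.eq_zero_of_inner_left ℂ ?_
    intro x
    rw [adjoint_inner_left, adjoint_inner_left, hM, hM, hd, hR, LinearPencil.toeplitz_lastComponent,
      LinearPencil.toeplitz_shift, LinearPencil.toeplitz_shift, inner_add_left, inner_shift_shift]
    simp [inner_lastComponent_left, shift_apply_zero]
  -- The wandering subspace of `M`, the orthogonal complement of its range.
  let Y : Submodule ℂ E := (adjoint M).ker
  have hY : IsClosed (Y : Set E) := (adjoint M).isClosed_ker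
  have : CompleteSpace Y := hY.completeSpace_coe
  let F : LinearPencil H Y :=
    { coeff0 := (d - M ∘L adjoint M ∘L d).codRestrict Y fun h => by
        simp [Y, LinearMap.mem_ker, hMM]
      coeff1 := (adjoint M ∘L d).codRestrict Y fun h => hMMd h }
  have hF0 : ∀ h, (F.coeff0 h : E) = d h - M (adjoint M (d h)) := fun _ => rfl
  have hF1 : ∀ h, (F.coeff1 h : E) = adjoint M (d h) := fun _ => rfl
  have hYM : ∀ (c : Y) e, inner ℂ (c : E) (M e) = 0 := fun c e => by
    rw [← adjoint_inner_left]
    have : adjoint M (c : E) = 0 := c.2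
    rw [this, inner_zero_left]
  have hF0c : ∀ h (c : Y), inner ℂ (c : E) (d h) = inner ℂ c (F.coeff0 h) := fun h c => by
    rw [Submodule.coe_inner, hF0, inner_sub_right, hYM, sub_zero]
  -- All terms of `x` beyond the zeroth contribute to `R x` a vector in the range of `M`, invisible
  -- to `Y`.
  have hRc : ∀ x (c : Y), inner ℂ (c : E) (R x) = inner ℂ c (F.coeff0 (x 0)) := fun x c => by
    obtain ⟨x', hx'⟩ := shift_add_lastComponent_surjective x
    conv_lhs => rw [hx', map_add, inner_add_right, ← hM, hYM, add_zero, ← hd, hF0c]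
  refine ⟨Y, inferInstance, inferInstance, inferInstance, F, ?_, fun h k => ?_, fun h k => ?_,
    fun c ε hε => ?_⟩
  · have horth : (F.coeff0.range)ᗮ = ⊥ := by
      rw [Submodule.eq_bot_iff]
      intro c hc
      have : (c : E) = 0 := by
        refine hRd.eq_zero_of_inner_left ℂ ?_
        intro x
        rw [hRc]
        exact (Submodule.mem_orthogonal' _ _).1 hc _ ⟨x 0, rfl⟩
      exact Subtype.ext this
    have := (Submodule.topologicalClosure_eq_top_iff).2 horth
    exact (Submodule.dense_iff_topologicalClosure_eq_top).2 this
  · rw [← hF0c k, Submodule.coe_inner, hF0, hF1, hF1, inner_sub_left,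
      ← adjoint_inner_right M, sub_add_cancel, hd, hd, hR, LinearPencil.toeplitz_lastComponent,
      LinearPencil.toeplitz_lastComponent]
    simp [inner_lastComponent_left, inner_shift_lastComponent, shift_apply_zero]
    ring
  · rw [← hF0c k, hF1, adjoint_inner_left, hd, hd, hM, hR, LinearPencil.toeplitz_shift,
      LinearPencil.toeplitz_lastComponent, LinearPencil.toeplitz_lastComponent]
    simp [inner_lastComponent_left, shift_apply_zero]
  -- Approximate `c` by `R x`; the required expression is `‖c - R x‖ ^ 2` expanded.
  · obtain ⟨x, hx⟩ := hRd.exists_mem_open (isOpen_Iio.preimage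
      (show Continuous fun e : E => ‖(c : E) - e‖ ^ 2 by fun_prop)) ⟨c, by simpa using hε⟩
    refine ⟨x, ?_⟩
    have h : ‖(c : E) - R x‖ ^ 2 < ε := hx
    rw [norm_sub_sq (𝕜 := ℂ), hRc, hRn, RCLike.re_to_complex, ← Submodule.coe_norm] at h
    linarith

end Factorization

/-! ### From the coefficient identities to an outer factor -/

section Outer

variable {H : Type u} [NormedAddCommGroup H] [InnerProductSpace ℂ H]
  {Y : Type v} [NormedAddCommGroup Y] [InnerProductSpace ℂ Y]
  {T : LinearPencil H H} {F : LinearPencil H Y}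

theorem norm_sq_toeplitz_add_norm_sq_toeplitz
    (hdiag : ∀ h k, inner ℂ (F.coeff0 h) (F.coeff0 k) + inner ℂ (F.coeff1 h) (F.coeff1 k) =
      inner ℂ h k - inner ℂ (T.coeff0 h) (T.coeff0 k) - inner ℂ (T.coeff1 h) (T.coeff1 k))
    (hoff : ∀ h k, inner ℂ (F.coeff1 h) (F.coeff0 k) = - inner ℂ (T.coeff1 h) (T.coeff0 k))
    (x : lp (fun _ : ℕ => H) 2) :
    ‖F.toeplitz x‖ ^ 2 + ‖T.toeplitz x‖ ^ 2 = ‖x‖ ^ 2 := by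
  let u : H → ℝ := fun a => ‖F.coeff0 a‖ ^ 2 + ‖T.coeff0 a‖ ^ 2
  let v : H → ℝ := fun a => ‖F.coeff1 a‖ ^ 2 + ‖T.coeff1 a‖ ^ 2
  have huv : ∀ a, u a + v a = ‖a‖ ^ 2 := fun a => by
    have h := hdiag a a
    simp only [inner_self_eq_norm_sq_to_K] at h
    have h' : ‖F.coeff0 a‖ ^ 2 + ‖F.coeff1 a‖ ^ 2 =
      ‖a‖ ^ 2 - ‖T.coeff0 a‖ ^ 2 - ‖T.coeff1 a‖ ^ 2 := by exact_mod_cast h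
    linarith
  have hu0 : ∀ a, 0 ≤ u a := fun a => by positivity
  have hv0 : ∀ a, 0 ≤ v a := fun a => by positivity
  -- The mixed terms of `F` and `T` cancel by `hoff`. Each `x k` then contributes `u` at place `k`
  -- and `v` at place `k + 1`, and these add up to `‖x k‖ ^ 2`.
  have hcross : ∀ a b, ‖F.coeff0 a + F.coeff1 b‖ ^ 2 + ‖T.coeff0 a + T.coeff1 b‖ ^ 2 =
      u a + v b := fun a b => by
    have h := congrArg Complex.re (hoff b a)
    rw [add_comm (F.coeff0 a), add_comm (T.coeff0 a), norm_add_sq (𝕜 := ℂ), norm_add_sq (𝕜 := ℂ),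
      RCLike.re_to_complex, RCLike.re_to_complex, h, Complex.neg_re]
    ring
  have hx := hasSum_norm_sq_lp_two x
  have hu : Summable fun k => u (x k) := Summable.of_nonneg_of_le (fun k => hu0 _)
    (fun k => by linarith [huv (x k), hv0 (x k)]) hx.summable
  have hv : Summable fun k => v (x k) := Summable.of_nonneg_of_le (fun k => hv0 _)
    (fun k => by linarith [huv (x k), hu0 (x k)]) hx.summable
  have hL := (hasSum_norm_sq_lp_two (F.toeplitz x)).add (hasSum_norm_sq_lp_two (T.toeplitz x))
  rw [← hasSum_nat_add_iff' 1] at hL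
  have hR := ((hasSum_nat_add_iff' 1).2 hu.hasSum).add hv.hasSum
  simp only [LinearPencil.toeplitz_apply_succ, hcross, Finset.sum_range_one,
    LinearPencil.toeplitz_apply_zero] at hL hR
  have h1 := hL.unique hR
  have h2 := (hu.hasSum.add hv.hasSum).unique (by simpa only [huv] using hx)
  linarith

theorem inner_eval_eval (A : LinearPencil H Y) {ζ : ℂ} (hζ : ‖ζ‖ = 1) (h k : H) :
    inner ℂ (A.eval ζ h) (A.eval ζ k) =
      inner ℂ (A.coeff0 h) (A.coeff0 k) + inner ℂ (A.coeff1 h) (A.coeff1 k) +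
      ζ * starRingEnd ℂ (inner ℂ (A.coeff1 k) (A.coeff0 h)) +
      starRingEnd ℂ ζ * inner ℂ (A.coeff1 h) (A.coeff0 k) := by
  have hz : starRingEnd ℂ ζ * ζ = 1 := by
    rw [Complex.conj_mul', hζ]
    simp
  simp only [LinearPencil.eval_apply, inner_add_left, inner_add_right, inner_smul_left,
    inner_smul_right, inner_conj_symm]
  linear_combination inner ℂ (A.coeff1 h) (A.coeff1 k) * hz

theorem adjoint_eval_comp_eval [CompleteSpace H] [CompleteSpace Y]
    (hdiag : ∀ h k, inner ℂ (F.coeff0 h) (F.coeff0 k) + inner ℂ (F.coeff1 h) (F.coeff1 k) =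
      inner ℂ h k - inner ℂ (T.coeff0 h) (T.coeff0 k) - inner ℂ (T.coeff1 h) (T.coeff1 k))
    (hoff : ∀ h k, inner ℂ (F.coeff1 h) (F.coeff0 k) = - inner ℂ (T.coeff1 h) (T.coeff0 k))
    {ζ : ℂ} (hζ : ‖ζ‖ = 1) :
    adjoint (F.eval ζ) ∘L F.eval ζ =
      ContinuousLinearMap.id ℂ H - adjoint (T.eval ζ) ∘L T.eval ζ := by
  ext k
  refine ext_inner_left ℂ fun h => ?_
  simp only [comp_apply, sub_apply, id_apply, inner_sub_right, adjoint_inner_right]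
  rw [inner_eval_eval F hζ, inner_eval_eval T hζ, hdiag, hoff, hoff, map_neg]
  ring

/-- The closure of the range is shift invariant, so it contains all singly supported sequences as
soon as it contains the constants. -/
theorem denseRange_toeplitz_of_lastComponent (A : LinearPencil H Y)
    (h : ∀ c : Y, lastComponent Y c ∈ closure (Set.range A.toeplitz)) :
    DenseRange A.toeplitz := by
  let L : Submodule ℂ (lp (fun _ : ℕ => Y) 2) := A.toeplitz.range.topologicalClosure
  have hL : (L : Set (lp (fun _ : ℕ => Y) 2)) = closure (Set.range A.toeplitz) := rfl
  have hshift : ∀ y ∈ L, shift Y y ∈ L := fun y hy =>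
    map_mem_closure (shift Y).continuous hy fun _ ⟨x, hx⟩ =>
      ⟨shift H x, (A.toeplitz_shift x).trans (congrArg _ hx)⟩
  have hsingle : ∀ k c, lp.single 2 k c ∈ L := fun k c => by
    induction k with
    | zero => exact h c
    | succ k ih =>
      rw [← shift_single]
      exact hshift _ ih
  intro y
  exact isClosed_closure.mem_of_tendsto
    (lp.hasSum_single (E := fun _ : ℕ => Y) (p := 2) (by simp) y)
    (Eventually.of_forall fun s => L.sum_mem fun k _ => hsingle k _)

theorem exists_isOuterFactor [CompleteSpace H] (T : LinearPencil H H) (hT : T.IsContractive) :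
    ∃ (Y : Type u) (_ : NormedAddCommGroup Y) (_ : InnerProductSpace ℂ Y) (_ : CompleteSpace Y)
      (F : LinearPencil H Y), DenseRange F.coeff0 ∧ IsOuterFactor T F := by
  obtain ⟨Y, _, _, _, F, hd, hdiag, hoff, hext⟩ := exists_extremal_factor T hT
  have hfac : ∀ ζ : ℂ, ‖ζ‖ = 1 → adjoint (F.eval ζ) ∘L F.eval ζ =
      ContinuousLinearMap.id ℂ H - adjoint (T.eval ζ) ∘L T.eval ζ := fun ζ hζ =>
    adjoint_eval_comp_eval hdiag hoff hζ
  refine ⟨Y, _, _, _, F, hd, F.isOuter_of_denseRange_toeplitz (fun ζ hζ => ?_) ?_, hfac⟩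
  · refine opNorm_le_bound _ zero_le_one fun x => ?_
    rw [one_mul, ← sq_le_sq₀ (norm_nonneg _) (norm_nonneg _), norm_sq_eval_of_factor (hfac ζ hζ)]
    exact sub_le_self _ (by positivity)
  · refine denseRange_toeplitz_of_lastComponent F fun c => ?_
    rw [Metric.mem_closure_iff]
    intro ε hε
    obtain ⟨x, hx⟩ := hext c (ε ^ 2) (by positivity)
    refine ⟨_, ⟨x, rfl⟩, ?_⟩
    -- Only the zeroth entry of `F.toeplitz x` meets `c`, and its norm is given by `‖x‖ ^ 2 -
    -- ‖T.toeplitz x‖ ^ 2`, so the distance is the extremal expression.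
    rw [dist_eq_norm, ← sq_lt_sq₀ (norm_nonneg _) hε.le, norm_sub_sq (𝕜 := ℂ),
      inner_lastComponent_left, LinearPencil.toeplitz_apply_zero, LinearIsometry.norm_map,
      RCLike.re_to_complex]
    linarith [norm_sq_toeplitz_add_norm_sq_toeplitz hdiag hoff x]

end Outer

end

theorem mainTheorem1 {H : Type u} [NormedAddCommGroup H] [InnerProductSpace ℂ H]
    [CompleteSpace H] [TopologicalSpace.SeparableSpace H]
    (T : LinearPencil H H) (hT : T.IsContractive) :
    (∃ (Y : Type u) (_ : NormedAddCommGroup Y) (_ : InnerProductSpace ℂ Y)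
        (_ : CompleteSpace Y) (_ : TopologicalSpace.SeparableSpace Y) (F : LinearPencil H Y),
        IsOuterFactor T F) ∧
    ∀ (Y : Type v) [NormedAddCommGroup Y] [InnerProductSpace ℂ Y] [CompleteSpace Y]
      [TopologicalSpace.SeparableSpace Y] (F : LinearPencil H Y), IsOuterFactor T F →
      IsMinimalIsometricDilation (embedKPlus Y H) T (canonicalPencil T F) ∧
      IsMinimalUniformIsometricDilation (embedKPlus Y H) T (canonicalPencil T F) := by
  refine ⟨?_, fun Y _ _ _ _ F hF => isMinimal_canonicalPencil hT hF⟩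
  obtain ⟨Y, _, _, _, F, hd, hF⟩ := exists_isOuterFactor T hT
  -- `Y` is separable because `F₀` maps the separable space `H` onto a dense subset.
  exact ⟨Y, _, _, _, hd.separableSpace F.coeff0.continuous, F, hF⟩
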